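/- \textbf{Setting.} Fix a finite set of unitary gates (each acting on finitely many qubits). A \emph{QPT algorithm} is a uniform family of quantum circuits over these gates: a deterministic Turing machine reads the classical parameters and writes, in time polynomial in their length, the circuit that is run on the input qubits and on ancilla qubits initialised to $|0\rangle$; a decision is obtained by measuring one output qubit in the computational basis. A positive function $\mu:\mathbb N\to\mathbb R$ is \emph{negligible} if for every $c\in\mathbb N$ one has $\mu(n)<n^{-c}$ for all sufficiently large $n$; $f(n)=\operatorname{negl}(\lambda(n))$ means $f(n)\le\mu(\lambda(n))$ for all $n$ and some negligible $\mu$. $\operatorname{poly}(n)$ denotes a function $\mathbb N\to\mathbb N$ bounded by a polynomial in $n$. The \emph{generalized Hilbert--Schmidt ensemble} $\eta_{n,m}$ is the law of $\operatorname{tr}_m(|\psi\rangle\langle\psi|)$, where $|\psi\rangle$ is a Haar random pure state of $n+m$ qubits and $\operatorname{tr}_m$ traces out $m$ of them. Let $\lambda=\lambda(n)=\operatorname{poly}(n)$, $\mathcal K=\{0,1\}^{\lambda}$ and $m=m(n)\in\mathbb N$. A keyed family $\{\rho_{k,m}\}_{k\in\mathcal K}$ of $n$-qubit density matrices (one family for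 every $n$) is a \emph{verifiable pseudorandom density matrix} (VPRDM) with mixedness parameter $m$ if \begin{enumerate} \item there is a QPT algorithm $\mathcal G$ with $\mathcal G(1^n,1^{\lambda},k,m)=\rho_{k,m}$ for all $n$ and $k$; \item for every QPT algorithm $\mathcal A$ (which knows $1^n,1^\lambda,1^t$) and every $t=\operatorname{poly}(n)$, $$\Big|\Pr_{k\leftarrow\mathcal K}[\mathcal A(\rho_{k,m}^{\otimes t})=1]-\Pr_{\rho\leftarrow\eta_{n,m}}[\mathcal A(\rho^{\otimes t})=1]\Big|=\operatorname{negl}(\lambda);$$ \item there is a QPT algorithm $\mathcal V$ (which knows $1^n,1^\lambda$) with $\Pr[\mathcal V(\rho_{k,m},k,m)=1]=1$ for all $n$ and $k$, and $\Pr_{k'\leftarrow\mathcal K\setminus\{k\}}[\mathcal V(\rho_{k,m},k',m)=1]=\operatorname{negl}(\lambda)$, uniformly in $k$. \end{enumerate} \textbf{Corollary.} Let $\{\rho_{k,m}\}_{k\in\mathcal K}$ be a VPRDM whose mixedness parameter satisfies $m=\omega(\log n)$, and let $\sigma_n=I_n/2^n$ be the $n$-qubit maximally mixed state. Then for every QPT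 algorithm $\mathcal A$ (which knows $1^n,1^\lambda,1^t$) and every $t=\operatorname{poly}(n)$, $$\Big|\Pr_{k\leftarrow\mathcal K}[\mathcal A(\rho_{k,m}^{\otimes t})=1]-\Pr[\mathcal A(\sigma_n^{\otimes t})=1]\Big|=\operatorname{negl}(\lambda).$$ -/

import Mathlib

open Matrix MeasureTheory Filter Asymptotics

noncomputable section

namespace QCrypto

/-! ## Qubits, matrices and states -/

/-- Bit strings of length `n`: the labels of the computational basis of `n` qubits. -/
abbrev Bits (n : ℕ) : Type := Fin n → Bool

/-- Operators on `n` qubits, in the computational basis. -/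
abbrev QMat (n : ℕ) : Type := Matrix (Bits n) (Bits n) ℂ

open scoped ComplexOrder in
/-- `ρ` is a density matrix. -/
def IsDensityMatrix {n : ℕ} (ρ : QMat n) : Prop :=
  ρ.PosSemidef ∧ ρ.trace = 1

/-- The basis state `|x⟩⟨x|`. -/
def basisState {n : ℕ} (x : Bits n) : QMat n :=
  Matrix.of fun y z => if y = x ∧ z = x then 1 else 0

/-- The maximally mixed state `I / 2 ^ n` of `n` qubits. -/
def maxMixed (n : ℕ) : QMat n := ((2 : ℂ) ^ n)⁻¹ • (1 : QMat n)

/-- The product state `ρ ⊗ τ` on `a + b` qubits. -/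
def tensor {a b : ℕ} (ρ : QMat a) (τ : QMat b) : QMat (a + b) :=
  Matrix.of fun x y =>
    ρ (fun i => x (Fin.castAdd b i)) (fun i => y (Fin.castAdd b i)) *
      τ (fun i => x (Fin.natAdd a i)) (fun i => y (Fin.natAdd a i))

/-- `t` copies `ρ ⊗ ⋯ ⊗ ρ` of an `n`-qubit state, on `t * n` qubits; the `i`-th qubit of the
`j`-th copy is the qubit number `j * n + i`. -/
def copies {n : ℕ} (t : ℕ) (ρ : QMat n) : QMat (t * n) :=
  Matrix.of fun x y =>
    ∏ j : Fin t, ρ (fun i => x (finProdFinEquiv (j, i))) (fun i => y (finProdFinEquiv (j, i)))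

/-- The partial trace over the last `b` of `a + b` qubits. -/
def traceRight {a b : ℕ} (ρ : QMat (a + b)) : QMat a :=
  Matrix.of fun x y => ∑ z : Bits b, ρ (Fin.append x z) (Fin.append y z)

/-- The partial trace over the first `a` of `a + b` qubits. -/
def traceLeft {a b : ℕ} (ρ : QMat (a + b)) : QMat b :=
  Matrix.of fun x y => ∑ z : Bits a, ρ (Fin.append z x) (Fin.append z y)

/-! ## Random states -/

/-- The Hilbert space of `n` qubits. -/
abbrev Hilb (n : ℕ) : Type := EuclideanSpace ℂ (Bits n)

/-- Unit vectors of `n` qubits. -/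
abbrev PureState (n : ℕ) : Type := Metric.sphere (0 : Hilb n) 1

/-- The projector `|ψ⟩⟨ψ|`. -/
def PureState.proj {n : ℕ} (ψ : PureState n) : QMat n :=
  Matrix.of fun x y => ψ.1 x * star (ψ.1 y)

/-- The surface measure of the unit sphere (coming from Lebesgue measure, up to scaling). -/
def surfaceMeasure (n : ℕ) : Measure (PureState n) :=
  (Measure.addHaar : Measure (Hilb n)).toSphere

/-- The Haar (uniform) probability measure on the `n`-qubit pure states. -/
def haarState (n : ℕ) : Measure (PureState n) :=
  (surfaceMeasure n Set.univ)⁻¹ • surfaceMeasure n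

/-- A member of the generalized Hilbert-Schmidt ensemble `η_{n,m}`: the `n`-qubit state left after
tracing out `m` qubits of an `(n + m)`-qubit pure state.  The ensemble is the law of this state
when `ψ` has law `haarState (n + m)`. -/
def reducedState (n m : ℕ) (ψ : PureState (n + m)) : QMat n := traceRight ψ.proj

/-! ## Quantum circuits -/

/-- A finite set of elementary quantum gates. -/
structure GateSet where
  /-- the number of gates -/
  card : ℕ
  /-- the number of qubits that a gate acts on -/
  arity : Fin card → ℕ
  /-- the unitary matrix of a gate -/
  gate : ∀ g, Matrix.unitaryGroup (Bits (arity g)) ℂ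

/-- The operator on `N` qubits that applies `U` to the qubits `w 0, …, w (a - 1)` and the identity
to all the others. -/
def onWires {a N : ℕ} (U : QMat a) (w : Fin a → Fin N) : QMat N :=
  open Classical in
  Matrix.of fun x y =>
    if ∀ i, i ∉ Set.range w → x i = y i then U (fun j => x (w j)) (fun j => y (w j)) else 0

/-- The operator of one instruction on `N` qubits.  The instruction `[g, w₀, …, w_{a-1}]` applies
the gate number `g`, of arity `a`, to the distinct qubits `w₀, …, w_{a-1}`.  Malformed instructions
do nothing. -/
def instrMatrix (G : GateSet) (N : ℕ) : List ℕ → QMat N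
  | [] => 1
  | g :: ws =>
      if hg : g < G.card then
        if hw : ws.length = G.arity ⟨g, hg⟩ ∧ ws.Nodup ∧ ∀ v ∈ ws, v < N then
          onWires (G.gate ⟨g, hg⟩ : QMat (G.arity ⟨g, hg⟩))
            (fun j => ⟨ws.get (j.cast hw.1.symm), hw.2.2 _ (ws.get_mem _)⟩)
        else 1
      else 1

/-- A circuit: the number of work qubits and the list of instructions, the first one executed
first. -/
structure Circuit where
  /-- the number of work qubits -/
  work : ℕ
  /-- the instructions -/
  instrs : List (List ℕ)

/-- The unitary of the circuit on `N` qubits. -/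
def Circuit.matrix (G : GateSet) (N : ℕ) (C : Circuit) : QMat N :=
  C.instrs.foldl (fun M ins => instrMatrix G N ins * M) 1

/-- The quantum operation that a circuit performs on a state `ρ` of `inp` qubits, with an outcome of
`out` qubits.  The qubits are: first the `inp` input qubits, then `out` output qubits, then the work
qubits, where output and work qubits are initially `|0⟩`.  The circuit is run and all but the output
qubits are traced out. -/
def Circuit.run (G : GateSet) (C : Circuit) {inp : ℕ} (out : ℕ) (ρ : QMat inp) : QMat out :=
  let U : QMat (inp + (out + C.work)) := C.matrix G _
  traceRight (traceLeft (U * tensor ρ (basisState fun _ => false) * Uᴴ))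

/-- The probability that a circuit with a single output qubit outputs `1` on the input `ρ`, when the
output qubit is measured in the computational basis. -/
def Circuit.acceptProb (G : GateSet) (C : Circuit) {inp : ℕ} (ρ : QMat inp) : ℝ :=
  (C.run G 1 ρ (fun _ => true) (fun _ => true)).re

/-! ## Quantum polynomial-time algorithms -/

/-- The strings that the classical machines read and write consist of bits and commas (`none`). -/
abbrev Str : Type := List (Option Bool)

/-- The list of a string's blocks, each of them ended by a comma. -/
def joinBlocks (bs : List (List Bool)) : Str :=
  bs.flatMap fun b => b.map some ++ [none]

/-- The string of `n` ones. -/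
def unary (n : ℕ) : List Bool := List.replicate n true

/-- Read a list of numbers, written in unary with ones and separated by zeros: `11010` stands for
`[2, 1, 0]`. -/
def readUnary : List Bool → List ℕ
  | [] => [0]
  | true :: l =>
      match readUnary l with
      | [] => [1]
      | a :: as => (a + 1) :: as
  | false :: l => 0 :: readUnary l

/-- The blocks of a string that are ended by commas, each of them read as a list of numbers. -/
def readBlocks : Str → List Bool → List (List ℕ)
  | [], _ => []
  | none :: s, acc => readUnary acc.reverse :: readBlocks s []
  | some b :: s, acc => readBlocks s (b :: acc)

/-- The circuit that a string describes.  Its first block holds the number of work qubits, the others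
are the instructions. -/
def readCircuit (s : Str) : Circuit :=
  match readBlocks s [] with
  | [] => ⟨0, []⟩
  | hd :: tl => ⟨hd.headD 0, tl⟩

/-- A quantum polynomial-time (QPT) algorithm: a uniform family of quantum circuits.  A classical
deterministic Turing machine reads the classical parameters and writes down, in time polynomial in
the length of what it reads, the description of the circuit to be run. -/
structure QPTAlgorithm where
  /-- the function computed by the Turing machine -/
  describe : Str → Str
  /-- the Turing machine runs in polynomial time -/
  polyTime : Nonempty (Turing.TM2ComputableInPolyTime id id describe)

/-- The circuit that the algorithm runs on the classical parameters `p`. -/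
def QPTAlgorithm.circuit (A : QPTAlgorithm) (p : List (List Bool)) : Circuit :=
  readCircuit (A.describe (joinBlocks p))

/-! ## Asymptotics -/

/-- `f` is bounded by a polynomial. -/
def PolyBounded (f : ℕ → ℕ) : Prop :=
  ∃ p : Polynomial ℕ, ∀ n, f n ≤ p.eval n

/-- Negligible functions. -/
def Negligible (μ : ℕ → ℝ) : Prop :=
  (∀ n, 0 < μ n) ∧ ∀ c : ℕ, ∃ n₀ : ℕ, ∀ n > n₀, μ n < ((n : ℝ) ^ c)⁻¹

/-- `f n = negl(l n)`. -/
def IsNegl (l : ℕ → ℕ) (f : ℕ → ℝ) : Prop :=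
  ∃ μ : ℕ → ℝ, Negligible μ ∧ ∀ n, f n ≤ μ (l n)

/-! ## Verifiable pseudorandom density matrices -/

/-- The average of `f k` over a uniformly random key `k ∈ {0,1}^l`. -/
def keyAverage {l : ℕ} (f : Bits l → ℝ) : ℝ := (∑ k, f k) / 2 ^ l

/-- The average of `f k'` over a uniformly random key `k' ∈ {0,1}^l` other than `k`. -/
def otherKeyAverage {l : ℕ} (k : Bits l) (f : Bits l → ℝ) : ℝ :=
  (∑ k' ∈ Finset.univ.erase k, f k') / (2 ^ l - 1)

/-- The probability that the distinguisher `A`, who knows `1^n`, `1^l` and `1^t`, outputs `1` when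
given `t` copies of the `n`-qubit state `ρ`. -/
def distProb (G : GateSet) (A : QPTAlgorithm) (n l t : ℕ) (ρ : QMat n) : ℝ :=
  (A.circuit [unary n, unary l, unary t]).acceptProb G (copies t ρ)

/-- The classical parameters of generation and verification: `1^n`, `1^l`, and `m` in binary. -/
def genParams (n l m : ℕ) : List (List Bool) :=
  [unary n, unary l, Computability.encodeNat m]

/-- The state that the algorithm `S` outputs on the parameters `(1^n, 1^l, m)` and the key `k`. -/
def genState (G : GateSet) (S : QPTAlgorithm) (n l m : ℕ) (k : Bits l) : QMat n :=
  (S.circuit (genParams n l m)).run G n (basisState k)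

/-- The probability that the verifier `V` outputs `1` on the parameters `(1^n, 1^l, m)`, the key `k`
and the state `ρ`. -/
def verProb (G : GateSet) (V : QPTAlgorithm) (n l m : ℕ) (k : Bits l) (ρ : QMat n) : ℝ :=
  (V.circuit (genParams n l m)).acceptProb G (tensor (basisState k) ρ)

/-- `ρ n k`, for `k ∈ {0,1}^(lam n)`, is a family of `n`-qubit verifiable pseudorandom density
matrices (VPRDM) with security parameter `lam n` and mixedness parameter `m n`. -/
structure IsVPRDM (G : GateSet) (lam m : ℕ → ℕ) (ρ : ∀ n, Bits (lam n) → QMat n) : Prop where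
  /-- the security parameter is polynomial in `n` -/
  lam_poly : PolyBounded lam
  /-- the `ρ n k` are density matrices -/
  density : ∀ n k, IsDensityMatrix (ρ n k)
  /-- efficient preparation -/
  preparable : ∃ S : QPTAlgorithm, ∀ n k, genState G S n (lam n) (m n) k = ρ n k
  /-- polynomially many copies are computationally indistinguishable from as many copies of a
  random state from the generalized Hilbert-Schmidt ensemble -/
  indistinguishable : ∀ (A : QPTAlgorithm) (t : ℕ → ℕ), PolyBounded t →
    IsNegl lam fun n =>
      |keyAverage (fun k => distProb G A n (lam n) (t n) (ρ n k)) -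
        ∫ ψ, distProb G A n (lam n) (t n) (reducedState n (m n) ψ) ∂haarState (n + m n)|
  /-- efficient verification: completeness and soundness -/
  verifiable : ∃ V : QPTAlgorithm,
    (∀ n k, verProb G V n (lam n) (m n) k (ρ n k) = 1) ∧
    ∃ μ : ℕ → ℝ, Negligible μ ∧ ∀ n k,
      otherKeyAverage k (fun k' => verProb G V n (lam n) (m n) k' (ρ n k)) ≤ μ (lam n)

end QCrypto

end

namespace QCrypto

/-! ## Invariance and low moments of the Haar measure on pure states -/

/-! The Hilbert-Schmidt ensemble is an intermediate hybrid. By the definition of a VPRDM it is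
computationally indistinguishable from the keyed family. For `t` copies it is also within `2 t² / 2
^ m` of the maximally mixed state for every test, efficient or not (`abs_integral_sub_maxMixed_le`).
As `m = ω(log n)`, this bound beats every inverse polynomial in `n`. Since `lam` is polynomially
bounded, it is then negligible in `lam` (`isNegl_of_forall_pow`).

For the statistical bound, imagine the `t` traced out registers measured in the computational basis.
This splits `t` copies of the reduced state into a sum over outcomes `x` of unnormalised pure states
`slice x ψ`. If the strings `x j` are distinct, the Haar average of the slice is a multiple of the
identity: sign flips kill the off-diagonal entries and permutations of the amplitudes equalise the
diagonal ones (`integral_slice`). So only outcomes with a collision contribute to the difference, at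
most their total weight. The birthday bound reduces this weight to the expected collision
probability of a single measured register, `(2 ^ n + 1) / (2 ^ (n + m) + 1)`. This fourth moment of
the amplitudes is computed from the invariance of Haar measure alone, with a Hadamard mixing of two
amplitudes (`haarMoment_add_self`). -/

open scoped Pointwise in
/-- The map of unit spheres induced by a linear isometry preserves the surface measure. -/
theorem measurePreserving_toSphere {E : Type*} [NormedAddCommGroup E] [NormedSpace ℝ E]
    [MeasurableSpace E] [BorelSpace E] [FiniteDimensional ℝ E] (μ : Measure E)
    [μ.IsAddHaarMeasure] (e : E ≃ₗᵢ[ℝ] E) :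
    MeasurePreserving (fun ψ : Metric.sphere (0 : E) 1 =>
      (⟨e ψ.1, by simp⟩ : Metric.sphere (0 : E) 1)) μ.toSphere μ.toSphere := by
  have hcont : Continuous (fun ψ : Metric.sphere (0 : E) 1 =>
      (⟨e ψ.1, by simp⟩ : Metric.sphere (0 : E) 1)) :=
    (e.continuous.comp continuous_subtype_val).subtype_mk _
  have hmap : μ.map e = μ := by
    have : (μ.map e).IsAddHaarMeasure :=
      e.toContinuousLinearEquiv.isAddHaarMeasure_map μ
    -- Haar measures agree up to a scalar, and the unit ball, which `e` preserves, shows that the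
    -- scalar is 1.
    have h := Measure.isAddLeftInvariant_eq_smul (μ.map e) μ
    set c := Measure.addHaarScalarFactor (μ.map e) μ
    have hb : μ.map e (Metric.ball 0 1) = μ (Metric.ball 0 1) := by
      rw [Measure.map_apply e.continuous.measurable measurableSet_ball]
      congr 1
      ext x
      simp
    rw [h, Measure.smul_apply] at hb
    have h0 : μ (Metric.ball (0 : E) 1) ≠ 0 := (Metric.measure_ball_pos μ 0 one_pos).ne'
    have h1 : μ (Metric.ball (0 : E) 1) ≠ ⊤ := measure_ball_lt_top.ne
    have hc : (c : ENNReal) = 1 := by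
      rw [ENNReal.smul_def, smul_eq_mul] at hb
      exact (ENNReal.mul_eq_right h0 h1).1 hb
    rw [h, ENNReal.coe_eq_one.1 hc, one_smul]
  refine ⟨hcont.measurable, ?_⟩
  ext s hs
  rw [Measure.map_apply hcont.measurable hs, Measure.toSphere_apply' _ hs,
    Measure.toSphere_apply' _ (hcont.measurable hs)]
  congr 1
  -- The surface measure of a set is defined through the volume of the cone over it; `e` commutes
  -- with scaling, so it maps cones to cones.
  have hset : (Set.Ioo (0 : ℝ) 1 • (Subtype.val '' ((fun ψ : Metric.sphere (0 : E) 1 =>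
      (⟨e ψ.1, by simp⟩ : Metric.sphere (0 : E) 1)) ⁻¹' s))) =
      e ⁻¹' (Set.Ioo (0 : ℝ) 1 • (Subtype.val '' s)) := by
    ext x
    simp only [Set.mem_smul, Set.mem_image, Set.mem_preimage, Subtype.exists, exists_and_right,
      exists_eq_right]
    constructor
    · rintro ⟨r, hr, y, ⟨hy, hys⟩, rfl⟩
      exact ⟨r, hr, e y, ⟨by simpa using hy, hys⟩, by simp⟩
    · rintro ⟨r, hr, y, ⟨hy, hys⟩, h⟩
      refine ⟨r, hr, e.symm y, ⟨by simpa using hy, by simpa using hys⟩, ?_⟩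
      rw [← map_smul, h, e.symm_apply_apply]
  rw [hset]
  conv_rhs => rw [← hmap]
  exact (e.toHomeomorph.toMeasurableEquiv.map_apply _).symm

section Haar

variable {n : ℕ}

/-- The action of a real linear isometry on pure states. -/
noncomputable def PureState.map (e : Hilb n ≃ₗᵢ[ℝ] Hilb n) (ψ : PureState n) : PureState n :=
  ⟨e ψ.1, by simp⟩

theorem PureState.continuous_map (e : Hilb n ≃ₗᵢ[ℝ] Hilb n) : Continuous (PureState.map e) :=
  (e.continuous.comp continuous_subtype_val).subtype_mk _

instance : IsFiniteMeasure (surfaceMeasure n) := by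
  unfold surfaceMeasure; infer_instance

instance : IsProbabilityMeasure (haarState n) := by
  have h : surfaceMeasure n Set.univ ≠ 0 := by
    rw [Measure.measure_univ_ne_zero]
    exact Measure.toSphere_ne_zero _
  refine ⟨?_⟩
  rw [haarState, Measure.smul_apply, smul_eq_mul]
  exact ENNReal.inv_mul_cancel h (measure_ne_top _ _)

theorem measurePreserving_map (e : Hilb n ≃ₗᵢ[ℝ] Hilb n) :
    MeasurePreserving (PureState.map e) (haarState n) (haarState n) :=
  (measurePreserving_toSphere _ e).smul_measure _

theorem integral_haarState_map {F : Type*} [NormedAddCommGroup F] [NormedSpace ℝ F]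
    (e : Hilb n ≃ₗᵢ[ℝ] Hilb n) {f : PureState n → F} (hf : Continuous f) :
    ∫ ψ, f (PureState.map e ψ) ∂haarState n = ∫ ψ, f ψ ∂haarState n := by
  have h := measurePreserving_map e
  conv_rhs => rw [← h.map_eq]
  refine (integral_map h.measurable.aemeasurable ?_).symm
  exact (Continuous.stronglyMeasurable_of_hasCompactSupport hf
    (HasCompactSupport.of_compactSpace f)).aestronglyMeasurable

theorem integrable_haarState {F : Type*} [NormedAddCommGroup F]
    {f : PureState n → F} (hf : Continuous f) : Integrable f (haarState n) :=
  hf.integrable_of_hasCompactSupport (HasCompactSupport.of_compactSpace f)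

/-- Permutation of the amplitudes. -/
noncomputable def permIsometry (σ : Equiv.Perm (Bits n)) : Hilb n ≃ₗᵢ[ℝ] Hilb n :=
  LinearIsometryEquiv.piLpCongrLeft 2 ℝ ℂ σ

theorem map_permIsometry (σ : Equiv.Perm (Bits n)) (ψ : PureState n) (i : Bits n) :
    (ψ.map (permIsometry σ)).1 (σ i) = ψ.1 i := by
  simp [PureState.map, permIsometry]

/-- Multiplication of the amplitudes by phases. -/
noncomputable def phaseIsometry (u : Bits n → Circle) : Hilb n ≃ₗᵢ[ℝ] Hilb n :=
  LinearIsometryEquiv.piLpCongrRight 2 fun i => rotation (u i)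

theorem map_phaseIsometry (u : Bits n → Circle) (ψ : PureState n) (i : Bits n) :
    (ψ.map (phaseIsometry u)).1 i = u i * ψ.1 i := by
  simp [PureState.map, phaseIsometry]

theorem PureState.continuous_apply (i : Bits n) : Continuous fun ψ : PureState n => ψ.1 i :=
  (EuclideanSpace.proj i : Hilb n →L[ℂ] ℂ).continuous.comp continuous_subtype_val

theorem PureState.sum_normSq (ψ : PureState n) : ∑ i, ‖ψ.1 i‖ ^ 2 = 1 := by
  rw [← EuclideanSpace.norm_sq_eq]
  simp

/-! ### Fourth moments by mixing two amplitudes -/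

/-- The Hadamard-like isometry that mixes two amplitudes. -/
noncomputable def mixLinearMap (i j : Bits n) : Hilb n →ₗ[ℝ] Hilb n where
  toFun v := WithLp.toLp 2 fun k => if k = i then ((√2 : ℝ) : ℂ)⁻¹ * (v i + v j) else
    if k = j then ((√2 : ℝ) : ℂ)⁻¹ * (v i - v j) else v k
  map_add' v w := by
    ext k
    simp only [PiLp.add_apply]
    split_ifs <;> ring
  map_smul' r v := by
    ext k
    simp only [PiLp.smul_apply, RingHom.id_apply, Complex.real_smul]
    split_ifs <;> ring

theorem norm_mixLinearMap {i j : Bits n} (hij : i ≠ j) (v : Hilb n) :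
    ‖mixLinearMap i j v‖ = ‖v‖ := by
  rw [← sq_eq_sq₀ (norm_nonneg _) (norm_nonneg _), EuclideanSpace.norm_sq_eq,
    EuclideanSpace.norm_sq_eq, ← Finset.add_sum_erase _ _ (Finset.mem_univ i),
    ← Finset.add_sum_erase _ _ (Finset.mem_univ i),
    ← Finset.add_sum_erase _ _ (Finset.mem_erase.2 ⟨hij.symm, Finset.mem_univ j⟩),
    ← Finset.add_sum_erase _ _ (Finset.mem_erase.2 ⟨hij.symm, Finset.mem_univ j⟩),
    ← add_assoc, ← add_assoc]
  congr 1
  · have h := parallelogram_law_with_norm ℝ (v i) (v j)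
    simp only [mixLinearMap, LinearMap.coe_mk, AddHom.coe_mk, if_true, if_neg hij.symm, norm_mul,
      norm_inv, Complex.norm_real, mul_pow, inv_pow, Real.norm_eq_abs, sq_abs]
    rw [Real.sq_sqrt zero_le_two]
    linarith
  · refine Finset.sum_congr rfl fun k hk => ?_
    simp only [Finset.mem_erase] at hk
    simp [mixLinearMap, hk.1, hk.2.1]

/-- The isometry given by `mixLinearMap`. -/
noncomputable def mixIsometry {i j : Bits n} (hij : i ≠ j) : Hilb n ≃ₗᵢ[ℝ] Hilb n :=
  LinearIsometry.toLinearIsometryEquiv ⟨mixLinearMap i j, norm_mixLinearMap hij⟩ rfl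

theorem map_mixIsometry_left {i j : Bits n} (hij : i ≠ j) (ψ : PureState n) :
    (ψ.map (mixIsometry hij)).1 i = ((√2 : ℝ) : ℂ)⁻¹ * (ψ.1 i + ψ.1 j) := by
  simp [PureState.map, mixIsometry, mixLinearMap]

theorem map_mixIsometry_right {i j : Bits n} (hij : i ≠ j) (ψ : PureState n) :
    (ψ.map (mixIsometry hij)).1 j = ((√2 : ℝ) : ℂ)⁻¹ * (ψ.1 i - ψ.1 j) := by
  simp [PureState.map, mixIsometry, mixLinearMap, hij.symm]

/-- The moment `E |ψ i|² |ψ j|²` of a Haar random state. -/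
noncomputable def haarMoment (i j : Bits n) : ℝ :=
  ∫ ψ : PureState n, ‖ψ.1 i‖ ^ 2 * ‖ψ.1 j‖ ^ 2 ∂haarState n

theorem continuous_moment (i j : Bits n) :
    Continuous fun ψ : PureState n => ‖ψ.1 i‖ ^ 2 * ‖ψ.1 j‖ ^ 2 :=
  ((PureState.continuous_apply i).norm.pow 2).mul ((PureState.continuous_apply j).norm.pow 2)

/-- Since `|a + b|² |a - b|² = (|a|² + |b|²)² - 4 Re(a b̄)²`, replacing `b` by `i b` turns the real
part into the imaginary part, and the two cross terms add up to `4 |a|² |b|²`. -/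
theorem normSq_add_mul_normSq_sub (a b : ℂ) :
    ‖((√2 : ℝ) : ℂ)⁻¹ * (a + b)‖ ^ 2 * ‖((√2 : ℝ) : ℂ)⁻¹ * (a - b)‖ ^ 2 +
      ‖((√2 : ℝ) : ℂ)⁻¹ * (a + Complex.I * b)‖ ^ 2 *
        ‖((√2 : ℝ) : ℂ)⁻¹ * (a - Complex.I * b)‖ ^ 2 =
      (‖a‖ ^ 2 * ‖a‖ ^ 2 + ‖b‖ ^ 2 * ‖b‖ ^ 2) / 2 := by
  simp only [norm_mul, norm_inv, Complex.norm_real, mul_pow, inv_pow, Real.norm_eq_abs, sq_abs,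
    Real.sq_sqrt zero_le_two]
  simp only [← Complex.normSq_eq_norm_sq, Complex.normSq_apply, Complex.add_re, Complex.add_im,
    Complex.sub_re, Complex.sub_im, Complex.mul_re, Complex.mul_im, Complex.I_re, Complex.I_im]
  ring

/-- Mixing the amplitudes `i` and `j` preserves the mixed moment, with or without a prior phase `i`
on the second one. Adding the two resulting expressions leaves only fourth powers. -/
theorem haarMoment_add_self {i j : Bits n} (hij : i ≠ j) :
    haarMoment i i + haarMoment j j = 4 * haarMoment i j := by
  classical
  have h1 := integral_haarState_map (mixIsometry hij) (continuous_moment i j)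
  obtain ⟨z, hz⟩ : ∃ z : Circle, (z : ℂ) = Complex.I :=
    ⟨⟨Complex.I, by simp [Submonoid.unitSphere]⟩, rfl⟩
  let u : Bits n → Circle := fun k => if k = j then z else 1
  have hc : Continuous fun ψ : PureState n =>
      ‖(ψ.map (mixIsometry hij)).1 i‖ ^ 2 * ‖(ψ.map (mixIsometry hij)).1 j‖ ^ 2 :=
    (continuous_moment i j).comp (PureState.continuous_map _)
  have h2 := integral_haarState_map (phaseIsometry u) hc
  rw [h1] at h2
  have h3 := congrArg₂ (· + ·) h1 h2
  simp only at h3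
  have hc' : Continuous fun ψ : PureState n =>
      ‖((ψ.map (phaseIsometry u)).map (mixIsometry hij)).1 i‖ ^ 2 *
        ‖((ψ.map (phaseIsometry u)).map (mixIsometry hij)).1 j‖ ^ 2 :=
    hc.comp (PureState.continuous_map (phaseIsometry u))
  rw [← integral_add (integrable_haarState hc) (integrable_haarState hc')] at h3
  simp only [map_mixIsometry_left, map_mixIsometry_right, map_phaseIsometry] at h3
  simp only [u, if_neg hij, if_true, hz, Circle.coe_one, one_mul, normSq_add_mul_normSq_sub] at h3
  rw [integral_div, integral_add (integrable_haarState (continuous_moment i i))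
    (integrable_haarState (continuous_moment j j))] at h3
  simp only [haarMoment]
  linarith

theorem sum_haarMoment : ∑ i : Bits n, ∑ j, haarMoment i j = 1 := by
  simp only [haarMoment]
  simp_rw [← integral_finsetSum _ fun j _ => integrable_haarState (continuous_moment _ j)]
  rw [← integral_finsetSum _ fun i _ => integrable_haarState
    (continuous_finsetSum _ fun j _ => continuous_moment i j)]
  simp_rw [← Finset.mul_sum, ← Finset.sum_mul, PureState.sum_normSq]
  simp

/-- With one formula for equal and distinct labels, double sums of moments reduce to diagonal sums,
and normalisation gives their total. -/
theorem haarMoment_eq (i j : Bits n) :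
    haarMoment i j =
      (haarMoment i i + haarMoment j j) / 4 * (1 + if i = j then 1 else 0) := by
  split_ifs with h
  · subst h; ring
  · rw [haarMoment_add_self h]; ring

theorem sum_sum_add_mul_ite {α : Type*} [Fintype α] [DecidableEq α] (f : α → ℝ) :
    ∑ i, ∑ j, (f i + f j) / 4 * (1 + if i = j then 1 else 0) =
      (Fintype.card α + 1) / 2 * ∑ i, f i := by
  simp_rw [mul_add, Finset.sum_add_distrib, mul_ite, mul_one, mul_zero, Finset.sum_ite_eq,
    Finset.mem_univ, if_true, add_div, Finset.sum_add_distrib, ← Finset.sum_div, Finset.sum_const,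
    ← Finset.smul_sum, Finset.card_univ, nsmul_eq_mul]
  ring

theorem sum_haarMoment_self : ∑ i : Bits n, haarMoment i i = 2 / (2 ^ n + 1) := by
  have h := sum_haarMoment (n := n)
  rw [Finset.sum_congr rfl fun i _ => Finset.sum_congr rfl fun j _ => haarMoment_eq i j,
    sum_sum_add_mul_ite (fun i : Bits n => haarMoment i i)] at h
  simp only [Fintype.card_pi, Fintype.card_bool, Finset.prod_const, Finset.card_univ,
    Fintype.card_fin, Nat.cast_pow, Nat.cast_ofNat] at h
  rw [eq_div_iff (by positivity)]
  linarith

/-- The expected purity of the marginal of a Haar random state on the second register, after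
dephasing. -/
theorem integral_sum_normSq_sq (a b : ℕ) :
    ∫ ψ : PureState (a + b), ∑ x : Bits b, (∑ y : Bits a, ‖ψ.1 (Fin.append y x)‖ ^ 2) ^ 2
      ∂haarState (a + b) = (2 ^ a + 1) / (2 ^ (a + b) + 1) := by
  have hS := sum_haarMoment_self (n := a + b)
  rw [← (Fin.appendEquiv a b).sum_comp, Fintype.sum_prod_type_right] at hS
  simp only [Fin.appendEquiv, Equiv.coe_fn_mk] at hS
  simp_rw [sq (∑ y : Bits a, _), Finset.sum_mul_sum]
  rw [integral_finsetSum _ fun x _ => integrable_haarState (continuous_finsetSum _ fun y _ =>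
    continuous_finsetSum _ fun z _ => continuous_moment _ _)]
  simp_rw [integral_finsetSum _ fun y _ => integrable_haarState (continuous_finsetSum _ fun z _ =>
    continuous_moment (Fin.append y _) (Fin.append z _)),
    integral_finsetSum _ fun y _ => integrable_haarState (
    continuous_moment (Fin.append _ _) (Fin.append y _))]
  change ∑ x, ∑ y, ∑ z, haarMoment (Fin.append y x) (Fin.append z x) = _
  have hinj : ∀ (x : Bits b) (y z : Bits a),
      Fin.append y x = Fin.append z x ↔ y = z := fun x y z => by
    have := (Fin.appendEquiv (α := Bool) a b).injective.eq_iff (a := (y, x)) (b := (z, x))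
    rwa [Prod.mk.injEq, and_iff_left rfl] at this
  -- For fixed `x` the labels `Fin.append y x` form a block of size `2 ^ a`. Only the sum of the
  -- diagonal moments over all blocks is needed afterwards.
  have key : ∀ x : Bits b, ∑ y : Bits a, ∑ z, haarMoment (Fin.append y x) (Fin.append z x) =
      (2 ^ a + 1) / 2 * ∑ y : Bits a, haarMoment (Fin.append y x) (Fin.append y x) := fun x => by
    have h := sum_sum_add_mul_ite fun y : Bits a => haarMoment (Fin.append y x) (Fin.append y x)
    simp only [Fintype.card_pi, Fintype.card_bool, Finset.prod_const, Finset.card_univ,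
      Fintype.card_fin, Nat.cast_pow, Nat.cast_ofNat] at h
    rw [← h]
    refine Finset.sum_congr rfl fun y _ => Finset.sum_congr rfl fun z _ => ?_
    rw [haarMoment_eq]
    simp only [hinj]
  simp_rw [key, ← Finset.mul_sum, hS]
  ring

/-! ### Moments of products of distinct amplitudes -/

/-- Moments in which some amplitude has no conjugate partner vanish. -/
theorem integral_prod_eq_zero {t : ℕ} (u v : Fin t → Bits n) (hu : Function.Injective u)
    {j₀ : Fin t} (hv : ∀ j, v j ≠ u j₀) :
    ∫ ψ : PureState n, ∏ j, (ψ.1 (u j) * star (ψ.1 (v j))) ∂haarState n = 0 := by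
  -- Flip the sign of the amplitude `u j₀`: it occurs exactly once, as `u` is injective and no `v j`
  -- equals it, so the integrand changes sign.
  let c : Bits n → Circle := fun k => if k = u j₀ then ⟨-1, by simp [Submonoid.unitSphere]⟩ else 1
  have hc : Continuous fun ψ : PureState n => ∏ j, (ψ.1 (u j) * star (ψ.1 (v j))) :=
    continuous_finsetProd _ fun j _ =>
      (PureState.continuous_apply _).mul (PureState.continuous_apply _).star
  have h := integral_haarState_map (phaseIsometry c) hc
  have h1 : ∀ ψ : PureState n, ∏ j, ((ψ.map (phaseIsometry c)).1 (u j) *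
      star ((ψ.map (phaseIsometry c)).1 (v j))) = -∏ j, (ψ.1 (u j) * star (ψ.1 (v j))) := by
    intro ψ
    rw [← Finset.mul_prod_erase _ _ (Finset.mem_univ j₀),
      ← Finset.mul_prod_erase (a := j₀) _ (fun j => ψ.1 (u j) * _) (Finset.mem_univ j₀), ← neg_mul]
    congr 1
    · simp [map_phaseIsometry, c, hv]
    · refine Finset.prod_congr rfl fun j hj => ?_
      simp [map_phaseIsometry, c, hv, hu.eq_iff, Finset.ne_of_mem_erase hj]
  simp_rw [h1, integral_neg] at h
  exact self_eq_neg.1 h.symm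

/-- Moments of distinct amplitudes do not depend on the choice of the amplitudes. -/
theorem integral_prod_normSq_eq {t : ℕ} {u v : Fin t → Bits n} (hu : Function.Injective u)
    (hv : Function.Injective v) :
    ∫ ψ : PureState n, ∏ j, (ψ.1 (u j) * star (ψ.1 (u j))) ∂haarState n =
      ∫ ψ : PureState n, ∏ j, (ψ.1 (v j) * star (ψ.1 (v j))) ∂haarState n := by
  obtain ⟨σ, hσ⟩ : ∃ σ : Equiv.Perm (Bits n), ∀ j, σ (v j) = u j := by
    have := Equiv.Perm.isMultiplyPretransitive (Bits n) t
    obtain ⟨σ, hσ⟩ := MulAction.exists_smul_eq (Equiv.Perm (Bits n))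
      (⟨v, hv⟩ : Fin t ↪ Bits n) ⟨u, hu⟩
    exact ⟨σ, fun j => congrArg (fun f : Fin t ↪ Bits n => f j) hσ⟩
  have hc : Continuous fun ψ : PureState n => ∏ j, (ψ.1 (u j) * star (ψ.1 (u j))) :=
    continuous_finsetProd _ fun j _ =>
      (PureState.continuous_apply _).mul (PureState.continuous_apply _).star
  rw [← integral_haarState_map (permIsometry σ) hc]
  simp_rw [← hσ, map_permIsometry]

end Haar

section Circuits

/-! ## Circuits are given by unitaries, and acceptance probabilities by effects -/

theorem onWires_mul {a N : ℕ} (U V : QMat a) {w : Fin a → Fin N} (hw : Function.Injective w) :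
    onWires U w * onWires V w = onWires (U * V) w := by
  classical
  ext x z
  simp only [Matrix.mul_apply, onWires, Matrix.of_apply]
  by_cases hxz : ∀ i, i ∉ Set.range w → x i = z i
  · rw [if_pos hxz]
    have : ∀ y : Bits N, ((if ∀ i, i ∉ Set.range w → x i = y i then
        U (fun j => x (w j)) (fun j => y (w j)) else 0) *
        if ∀ i, i ∉ Set.range w → y i = z i then V (fun j => y (w j)) (fun j => z (w j)) else 0) =
        if ∀ i, i ∉ Set.range w → x i = y i then
          U (fun j => x (w j)) (fun j => y (w j)) * V (fun j => y (w j)) (fun j => z (w j))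
        else 0 := by
      intro y
      by_cases hxy : ∀ i, i ∉ Set.range w → x i = y i
      · rw [if_pos hxy, if_pos hxy, if_pos fun i hi => (hxy i hi).symm.trans (hxz i hi)]
      · rw [if_neg hxy, if_neg hxy, zero_mul]
    rw [Finset.sum_congr rfl fun y _ => this y, ← Finset.sum_filter]
    -- The intermediate strings agree with `x` off the wires, so they correspond to `a`-bit strings:
    -- restrict to the wires, or overwrite `x` on them.
    refine Finset.sum_nbij' (fun y j => y (w j)) (fun u => Function.extend w u x) ?_ ?_ ?_ ?_ ?_
    · simp
    · intro u _
      simp only [Finset.mem_filter, Finset.mem_univ, true_and]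
      intro i hi
      rw [Function.extend_apply' _ _ _ hi]
    · intro y hy
      simp only [Finset.mem_filter, Finset.mem_univ, true_and] at hy
      ext i
      by_cases hi : i ∈ Set.range w
      · obtain ⟨j, rfl⟩ := hi
        rw [hw.extend_apply]
      · rw [Function.extend_apply' _ _ _ hi, hy i hi]
    · intro u _
      ext j
      rw [hw.extend_apply]
    · intro y _
      rfl
  · rw [if_neg hxz]
    refine Finset.sum_eq_zero fun y _ => ?_
    by_contra h
    refine hxz fun i hi => ?_
    have h1 := left_ne_zero_of_mul h
    have h2 := right_ne_zero_of_mul h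
    rw [ne_eq, ite_eq_right_iff, Classical.not_imp] at h1 h2
    exact (h1.1 i hi).trans (h2.1 i hi)

theorem onWires_one {a N : ℕ} (w : Fin a → Fin N) : onWires (1 : QMat a) w = 1 := by
  classical
  ext x z
  simp only [onWires, Matrix.of_apply, Matrix.one_apply]
  by_cases h : x = z
  · subst h; simp
  · rw [if_neg h, ite_eq_right_iff]
    intro h1
    rw [if_neg]
    intro h2
    refine h (funext fun i => ?_)
    by_cases hi : i ∈ Set.range w
    · obtain ⟨j, rfl⟩ := hi
      exact congrFun h2 j
    · exact h1 i hi

theorem conjTranspose_onWires {a N : ℕ} (U : QMat a) (w : Fin a → Fin N) :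
    (onWires U w)ᴴ = onWires Uᴴ w := by
  classical
  ext x z
  simp only [onWires, Matrix.of_apply, Matrix.conjTranspose_apply, apply_ite star, star_zero,
    eq_comm]

theorem instrMatrix_conjTranspose_mul (G : GateSet) (N : ℕ) (ins : List ℕ) :
    (instrMatrix G N ins)ᴴ * instrMatrix G N ins = 1 := by
  cases ins with
  | nil => simp [instrMatrix]
  | cons g ws =>
    rw [instrMatrix]
    split_ifs with hg hw
    · rw [conjTranspose_onWires, onWires_mul, ← Matrix.star_eq_conjTranspose,
        Matrix.UnitaryGroup.star_mul_self, onWires_one]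
      intro i j hij
      have := (hw.2.1.get_inj_iff).1 (Fin.mk.inj hij)
      simpa [Fin.ext_iff] using this
    · simp
    · simp

theorem Circuit.matrix_conjTranspose_mul (G : GateSet) (N : ℕ) (C : Circuit) :
    (C.matrix G N)ᴴ * C.matrix G N = 1 := by
  rw [Circuit.matrix]
  suffices h : ∀ (l : List (List ℕ)) (M : QMat N), Mᴴ * M = 1 →
      (l.foldl (fun M ins => instrMatrix G N ins * M) M)ᴴ *
        l.foldl (fun M ins => instrMatrix G N ins * M) M = 1 from h _ _ (by simp)
  intro l
  induction l with
  | nil => exact fun M hM => hM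
  | cons ins l ih =>
    intro M hM
    refine ih _ ?_
    rw [Matrix.conjTranspose_mul, Matrix.mul_assoc, ← Matrix.mul_assoc _ _ M,
      instrMatrix_conjTranspose_mul, Matrix.one_mul, hM]

theorem trace_traceRight {a b : ℕ} (ρ : QMat (a + b)) :
    (traceRight (a := a) (b := b) ρ).trace = ρ.trace := by
  simp only [Matrix.trace, Matrix.diag_apply, traceRight, Matrix.of_apply]
  rw [← (Fin.appendEquiv a b).sum_comp, Fintype.sum_prod_type]
  rfl

theorem trace_traceLeft {a b : ℕ} (ρ : QMat (a + b)) :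
    (traceLeft (a := a) (b := b) ρ).trace = ρ.trace := by
  simp only [Matrix.trace, Matrix.diag_apply, traceLeft, Matrix.of_apply]
  rw [← (Fin.appendEquiv a b).sum_comp, Fintype.sum_prod_type_right]
  rfl

theorem trace_tensor {a b : ℕ} (ρ : QMat a) (τ : QMat b) :
    (tensor ρ τ).trace = ρ.trace * τ.trace := by
  simp only [Matrix.trace, Matrix.diag_apply, tensor, Matrix.of_apply]
  rw [← (Fin.appendEquiv a b).sum_comp, Fintype.sum_prod_type, Finset.sum_mul_sum]
  simp [Fin.appendEquiv]

theorem trace_basisState {a : ℕ} (x : Bits a) : (basisState x).trace = 1 := by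
  simp [Matrix.trace, basisState]

open scoped ComplexOrder

theorem posSemidef_traceRight {a b : ℕ} {ρ : QMat (a + b)} (h : ρ.PosSemidef) :
    (traceRight (a := a) (b := b) ρ).PosSemidef := by
  have : traceRight (a := a) (b := b) ρ =
      ∑ z : Bits b, ρ.submatrix (fun x : Bits a => Fin.append x z) fun x => Fin.append x z := by
    ext x y
    simp [traceRight, Matrix.sum_apply]
  rw [this]
  exact Matrix.posSemidef_sum _ fun z _ => h.submatrix _

theorem posSemidef_traceLeft {a b : ℕ} {ρ : QMat (a + b)} (h : ρ.PosSemidef) :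
    (traceLeft (a := a) (b := b) ρ).PosSemidef := by
  have : traceLeft (a := a) (b := b) ρ =
      ∑ z : Bits a, ρ.submatrix (fun x : Bits b => Fin.append z x) fun x => Fin.append z x := by
    ext x y
    simp [traceLeft, Matrix.sum_apply]
  rw [this]
  exact Matrix.posSemidef_sum _ fun z _ => h.submatrix _

theorem posSemidef_tensor {a b : ℕ} {ρ : QMat a} {τ : QMat b} (hρ : ρ.PosSemidef)
    (hτ : τ.PosSemidef) : (tensor ρ τ).PosSemidef :=
  (hρ.kronecker hτ).submatrix fun x : Bits (a + b) =>
    (fun i => x (Fin.castAdd b i), fun i => x (Fin.natAdd a i))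

theorem posSemidef_basisState {a : ℕ} (x : Bits a) : (basisState x).PosSemidef := by
  have : basisState x = vecMulVec (Pi.single x (1 : ℂ)) (star (Pi.single x 1)) := by
    ext y z
    simp [basisState, vecMulVec_apply, Pi.single_apply, ite_and]
    split_ifs <;> rfl
  rw [this]
  exact Matrix.posSemidef_vecMulVec_self_star _

variable (G : GateSet) (C : Circuit) {inp : ℕ}

theorem Circuit.posSemidef_run (out : ℕ) {ρ : QMat inp} (h : ρ.PosSemidef) :
    (C.run G out ρ).PosSemidef :=
  posSemidef_traceRight <| posSemidef_traceLeft <|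
    (posSemidef_tensor h (posSemidef_basisState _)).mul_mul_conjTranspose_same _

theorem Circuit.trace_run (out : ℕ) (ρ : QMat inp) : (C.run G out ρ).trace = ρ.trace := by
  simp only [Circuit.run]
  rw [trace_traceRight, trace_traceLeft, Matrix.trace_mul_comm, ← Matrix.mul_assoc,
    Circuit.matrix_conjTranspose_mul, Matrix.one_mul, trace_tensor, trace_basisState, mul_one]

theorem Circuit.acceptProb_nonneg {ρ : QMat inp} (h : ρ.PosSemidef) : 0 ≤ C.acceptProb G ρ :=
  (Complex.le_def.1 (C.posSemidef_run G 1 h).diag_nonneg).1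

/-- The acceptance probability is one diagonal entry of a positive output with the same trace as the
input. The bound is by the trace rather than 1 because it is applied to unnormalised slices. -/
theorem Circuit.acceptProb_le_trace {ρ : QMat inp} (h : ρ.PosSemidef) :
    C.acceptProb G ρ ≤ ρ.trace.re := by
  rw [← C.trace_run G 1 ρ, Matrix.trace, Complex.re_sum]
  exact Finset.single_le_sum (f := fun x => (C.run G 1 ρ x x).re)
    (fun x _ => (Complex.le_def.1 (C.posSemidef_run G 1 h).diag_nonneg).1) (Finset.mem_univ _)

theorem Circuit.run_add (out : ℕ) (ρ τ : QMat inp) :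
    C.run G out (ρ + τ) = C.run G out ρ + C.run G out τ := by
  have h1 : ∀ {b : ℕ} (β : QMat b), tensor (ρ + τ) β = tensor ρ β + tensor τ β := fun β => by
    ext x y
    simp [tensor, add_mul]
  ext x y
  simp [Circuit.run, h1, Matrix.mul_add, Matrix.add_mul, traceRight, traceLeft,
    Finset.sum_add_distrib]

theorem Circuit.run_smul (out : ℕ) (c : ℂ) (ρ : QMat inp) :
    C.run G out (c • ρ) = c • C.run G out ρ := by
  have h1 : ∀ {b : ℕ} (β : QMat b), tensor (c • ρ) β = c • tensor ρ β := fun β => by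
    ext x y
    simp [tensor, mul_assoc]
  ext x y
  simp [Circuit.run, h1, traceRight, traceLeft, Finset.mul_sum]

/-- The acceptance probability of a circuit, as a real linear functional of the input. -/
noncomputable def Circuit.acceptFunctional : QMat inp →ₗ[ℝ] ℝ where
  toFun := C.acceptProb G
  map_add' ρ τ := by simp [Circuit.acceptProb, Circuit.run_add]
  map_smul' c ρ := by
    have h : c • ρ = (c : ℂ) • ρ := by ext; simp
    rw [Circuit.acceptProb, h, Circuit.run_smul]
    simp [Circuit.acceptProb]

end Circuits

/-! ## Copies of a reduced Haar random state are close to copies of the maximally mixed state -/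

/-- In the `t`-th power of a distribution, the collisions at two given places have the weight of the
collision probability. -/
theorem sum_filter_eq_prod {β : Type*} [Fintype β] [DecidableEq β] {t : ℕ} {p : β → ℝ}
    (hp : ∑ b, p b = 1) {i j : Fin t} (hij : i ≠ j) :
    ∑ x : Fin t → β with x i = x j, ∏ k, p (x k) = ∑ b, p b ^ 2 := by
  classical
  have h1 : ∀ b, ∑ x : Fin t → β with x i = b ∧ x j = b, ∏ k, p (x k) = p b ^ 2 := by
    intro b
    -- Fixing two coordinates gives a box, over which the sum of products factors; each free
    -- coordinate contributes total mass 1.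
    have h2 : (Finset.univ.filter fun x : Fin t → β => x i = b ∧ x j = b) =
        Fintype.piFinset fun k => if k = i ∨ k = j then {b} else Finset.univ := by
      ext x
      simp only [Finset.mem_filter, Finset.mem_univ, true_and, Fintype.mem_piFinset]
      constructor
      · rintro ⟨hi, hj⟩ k
        split_ifs with hk
        · rcases hk with rfl | rfl <;> simpa
        · simp
      · intro h
        exact ⟨by simpa using h i, by simpa using h j⟩
    rw [h2, ← Finset.prod_univ_sum (f := fun _ c => p c),
      ← Finset.mul_prod_erase _ _ (Finset.mem_univ i),
      ← Finset.mul_prod_erase _ _ (Finset.mem_erase.2 ⟨hij.symm, Finset.mem_univ j⟩),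
      Finset.prod_eq_one, sq]
    · simp
    · intro k hk
      simp only [Finset.mem_erase] at hk
      rw [if_neg (by tauto), hp]
  simp_rw [← h1]
  rw [← Finset.sum_fiberwise (Finset.univ.filter fun x : Fin t → β => x i = x j) (fun x => x i)]
  refine Finset.sum_congr rfl fun b _ => Finset.sum_congr ?_ fun _ _ => rfl
  ext x
  simp only [Finset.mem_filter, Finset.mem_univ, true_and]
  constructor
  · rintro ⟨h, rfl⟩; exact ⟨rfl, h.symm⟩
  · rintro ⟨rfl, h⟩; exact ⟨h.symm, rfl⟩

/-- The birthday bound. -/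
theorem sum_not_injective_le {β : Type*} [Fintype β] {t : ℕ}
    [DecidablePred fun x : Fin t → β => ¬ Function.Injective x] {p : β → ℝ}
    (h0 : ∀ b, 0 ≤ p b) (hp : ∑ b, p b = 1) :
    ∑ x : Fin t → β with ¬ Function.Injective x, ∏ k, p (x k) ≤ t ^ 2 * ∑ b, p b ^ 2 := by
  classical
  have hprod : ∀ x : Fin t → β, 0 ≤ ∏ k, p (x k) := fun x => Finset.prod_nonneg fun k _ => h0 _
  have hsq : 0 ≤ ∑ b, p b ^ 2 := Finset.sum_nonneg fun b _ => sq_nonneg _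
  -- Union bound over ordered pairs of distinct places.
  have hle : ∀ x : Fin t → β, (if ¬ Function.Injective x then ∏ k, p (x k) else 0) ≤
      ∑ q : Fin t × Fin t with q.1 ≠ q.2, if x q.1 = x q.2 then ∏ k, p (x k) else 0 := by
    intro x
    have hterm : ∀ q : Fin t × Fin t, 0 ≤ if x q.1 = x q.2 then ∏ k, p (x k) else 0 := fun q => by
      split_ifs
      exacts [hprod x, le_rfl]
    split_ifs with hx
    · exact Finset.sum_nonneg fun q _ => hterm q
    · simp only [Function.Injective, not_forall] at hx
      obtain ⟨i, j, h, hij⟩ := hx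
      have := Finset.single_le_sum (s := Finset.univ.filter fun q : Fin t × Fin t => q.1 ≠ q.2)
        (fun q _ => hterm q) (Finset.mem_filter.2 ⟨Finset.mem_univ (i, j), hij⟩)
      rwa [if_pos h] at this
  calc _ = ∑ x : Fin t → β, if ¬ Function.Injective x then ∏ k, p (x k) else 0 :=
        Finset.sum_filter _ _
    _ ≤ _ := Finset.sum_le_sum fun x _ => hle x
    _ = ∑ q : Fin t × Fin t with q.1 ≠ q.2, ∑ x : Fin t → β with x q.1 = x q.2,
          ∏ k, p (x k) := by
        rw [Finset.sum_comm]
        simp only [Finset.sum_filter]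
    _ = ∑ q : Fin t × Fin t with q.1 ≠ q.2, ∑ b, p b ^ 2 :=
      Finset.sum_congr rfl fun q hq => sum_filter_eq_prod hp (Finset.mem_filter.1 hq).2
    _ ≤ ∑ q : Fin t × Fin t, ∑ b, p b ^ 2 :=
      Finset.sum_le_sum_of_subset_of_nonneg (Finset.filter_subset _ _) fun _ _ _ => hsq
    _ = _ := by simp [sq]

/-- A string of `t * n` bits as `t` strings of `n` bits. -/
def splitBits (t n : ℕ) : Bits (t * n) ≃ (Fin t → Bits n) :=
  (Equiv.arrowCongr finProdFinEquiv.symm (Equiv.refl Bool)).trans (Equiv.curry _ _ _)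

theorem trace_of_prod {t n : ℕ} (g : Fin t → Bits n → Bits n → ℂ) :
    (Matrix.of fun Y Z => ∏ j, g j (splitBits t n Y j) (splitBits t n Z j)).trace =
      ∏ j, ∑ y, g j y y := by
  simp only [Matrix.trace, Matrix.diag_apply, Matrix.of_apply]
  rw [(splitBits t n).sum_comp fun Y => ∏ j, g j (Y j) (Y j), Finset.prod_univ_sum,
    Fintype.piFinset_univ]

theorem copies_maxMixed (n t : ℕ) :
    copies t (maxMixed n) = ((((2 : ℂ) ^ n) ^ t)⁻¹ : ℂ) • 1 := by
  ext Y Z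
  simp only [copies, maxMixed, Matrix.of_apply, Matrix.smul_apply, smul_eq_mul,
    Finset.prod_mul_distrib, Finset.prod_const, Finset.card_univ, Fintype.card_fin, inv_pow]
  congr 1
  by_cases h : Y = Z
  · subst h; simp
  · rw [Matrix.one_apply_ne h]
    obtain ⟨j, hj⟩ := Function.ne_iff.1 ((splitBits t n).injective.ne h)
    exact Finset.prod_eq_zero (Finset.mem_univ j) (Matrix.one_apply_ne hj)

/-! ### Expansion of `t` copies over the traced out strings -/

section Copies

variable {n m t : ℕ}

/-- The weight of the basis state `x` in the traced out register. -/
noncomputable def marginal (ψ : PureState (n + m)) (x : Bits m) : ℝ :=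
  ∑ y : Bits n, ‖ψ.1 (Fin.append y x)‖ ^ 2

theorem marginal_nonneg (ψ : PureState (n + m)) (x : Bits m) : 0 ≤ marginal ψ x :=
  Finset.sum_nonneg fun _ _ => sq_nonneg _

theorem sum_marginal (ψ : PureState (n + m)) : ∑ x, marginal ψ x = 1 := by
  rw [← ψ.sum_normSq, ← (Fin.appendEquiv n m).sum_comp, Fintype.sum_prod_type_right]
  rfl

theorem continuous_marginal (x : Bits m) :
    Continuous fun ψ : PureState (n + m) => marginal ψ x :=
  continuous_finsetSum _ fun _ _ => (PureState.continuous_apply _).norm.pow 2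

/-- The contribution to `t` copies of the reduced state of the measurement outcomes `x` in the traced
out registers. -/
def slice (x : Fin t → Bits m) (ψ : PureState (n + m)) : QMat (t * n) :=
  Matrix.of fun Y Z => ∏ j, (ψ.1 (Fin.append (splitBits t n Y j) (x j)) *
    star (ψ.1 (Fin.append (splitBits t n Z j) (x j))))

theorem copies_reducedState (ψ : PureState (n + m)) :
    copies t (reducedState n m ψ) = ∑ x : Fin t → Bits m, slice x ψ := by
  ext Y Z
  simp only [copies, reducedState, traceRight, PureState.proj, Matrix.of_apply, Matrix.sum_apply,
    slice, Finset.prod_univ_sum, Fintype.piFinset_univ]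
  rfl

theorem continuous_slice_apply (x : Fin t → Bits m) (Y Z : Bits (t * n)) :
    Continuous fun ψ : PureState (n + m) => slice x ψ Y Z := by
  simp only [slice, Matrix.of_apply]
  exact continuous_finsetProd _ fun _ _ =>
    (PureState.continuous_apply _).mul (PureState.continuous_apply _).star

theorem trace_slice (x : Fin t → Bits m) (ψ : PureState (n + m)) :
    (slice x ψ).trace = (∏ j, marginal ψ (x j) : ℝ) := by
  rw [slice, trace_of_prod fun j y z => ψ.1 (Fin.append y (x j)) * star (ψ.1 (Fin.append z (x j)))]
  simp [marginal, Complex.mul_conj']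

-- A slice is the rank-one operator of a product of `t` unnormalised post-measurement vectors.
open scoped ComplexOrder in
theorem posSemidef_slice (x : Fin t → Bits m) (ψ : PureState (n + m)) :
    (slice x ψ).PosSemidef := by
  have : slice x ψ = vecMulVec (fun Y => ∏ j, ψ.1 (Fin.append (splitBits t n Y j) (x j)))
      (star fun Y => ∏ j, ψ.1 (Fin.append (splitBits t n Y j) (x j))) := by
    ext Y Z
    simp [slice, vecMulVec_apply, Finset.prod_mul_distrib]
  rw [this]
  exact Matrix.posSemidef_vecMulVec_self_star _

theorem continuous_linearMap_comp {k N : ℕ} (F : QMat N →ₗ[ℝ] ℝ) {f : PureState k → QMat N}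
    (hf : ∀ Y Z, Continuous fun ψ => f ψ Y Z) : Continuous fun ψ => F (f ψ) :=
  F.continuous_of_finiteDimensional.comp (continuous_matrix hf)

theorem integral_linearMap_comp {k N : ℕ} (F : QMat N →ₗ[ℝ] ℝ) {f : PureState k → QMat N}
    (hf : ∀ Y Z, Continuous fun ψ => f ψ Y Z) :
    ∫ ψ, F (f ψ) ∂haarState k = F (Matrix.of fun Y Z => ∫ ψ, f ψ Y Z ∂haarState k) := by
  let F' : (Bits N → Bits N → ℂ) →L[ℝ] ℝ :=
    (F ∘ₗ (Matrix.ofLinearEquiv ℝ).toLinearMap).toContinuousLinearMap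
  have hint : Integrable (fun ψ Y Z => f ψ Y Z) (haarState k) :=
    integrable_haarState (continuous_pi fun Y => continuous_pi fun Z => hf Y Z)
  have h := F'.integral_comp_comm hint
  have h2 : (∫ ψ, (fun Y Z => f ψ Y Z) ∂haarState k) = fun Y Z => ∫ ψ, f ψ Y Z ∂haarState k := by
    ext Y Z
    rw [eval_integral fun Y => integrable_haarState (continuous_pi fun Z => hf Y Z),
      eval_integral fun Z => integrable_haarState (hf Y Z)]
  rw [h2] at h
  exact h

/-- Distinct `x j` make the labels `(y j, x j)` distinct for any `y`. If `Y` and `Z` differ in block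
`j₀`, the label of `Y` there has no conjugate partner and the entry vanishes; diagonal entries
coincide by permutation invariance. The trace fixes the scalar. -/
theorem integral_slice {x : Fin t → Bits m} (hx : Function.Injective x) :
    (Matrix.of fun Y Z => ∫ ψ : PureState (n + m), slice x ψ Y Z ∂haarState (n + m)) =
      (∫ ψ : PureState (n + m), ∏ j, marginal ψ (x j) ∂haarState (n + m)) •
        copies t (maxMixed n) := by
  have happ : ∀ (y z : Fin t → Bits n) (i j : Fin t),
      Fin.append (y i) (x i) = Fin.append (z j) (x j) → i = j ∧ y i = z j := by
    intro y z i j h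
    have := (Fin.appendEquiv (α := Bool) n m).injective (a₁ := (y i, x i)) (a₂ := (z j, x j)) h
    rw [Prod.mk.injEq] at this
    exact ⟨hx this.2, this.1⟩
  have hinj : ∀ y : Fin t → Bits n, Function.Injective fun j => Fin.append (y j) (x j) :=
    fun y i j h => (happ y y i j h).1
  obtain ⟨c, hc⟩ : ∃ c : ℂ, (Matrix.of fun Y Z => ∫ ψ : PureState (n + m), slice x ψ Y Z
      ∂haarState (n + m)) = c • (1 : QMat (t * n)) := by
    refine ⟨∫ ψ : PureState (n + m), slice x ψ (fun _ => false) (fun _ => false)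
      ∂haarState (n + m), ?_⟩
    ext Y Z
    by_cases h : Y = Z
    · subst h
      simp only [Matrix.of_apply, slice, Matrix.smul_apply, Matrix.one_apply_eq, smul_eq_mul,
        mul_one]
      exact integral_prod_normSq_eq (hinj _) (hinj _)
    · obtain ⟨j₀, hj⟩ := Function.ne_iff.1 ((splitBits t n).injective.ne h)
      rw [Matrix.smul_apply, Matrix.one_apply_ne h, smul_zero]
      simp only [Matrix.of_apply, slice]
      refine integral_prod_eq_zero _ _ (hinj _) (j₀ := j₀) fun j hjj => ?_
      obtain ⟨rfl, h2⟩ := happ _ _ _ _ hjj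
      exact hj h2.symm
  have htr := congrArg Matrix.trace hc
  have h1 : (Matrix.of fun Y Z => ∫ ψ : PureState (n + m), slice x ψ Y Z
      ∂haarState (n + m)).trace =
      ((∫ ψ : PureState (n + m), ∏ j, marginal ψ (x j) ∂haarState (n + m) : ℝ) : ℂ) := by
    rw [← integral_complex_ofReal]
    simp_rw [← trace_slice, Matrix.trace, Matrix.diag_apply, Matrix.of_apply]
    rw [integral_finsetSum _ fun Y _ => integrable_haarState (continuous_slice_apply x Y Y)]
  rw [h1] at htr
  have h2 : ((2 : ℂ) ^ n) ^ t ≠ 0 := pow_ne_zero _ (pow_ne_zero _ two_ne_zero)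
  rw [hc, copies_maxMixed, ← smul_assoc, Complex.real_smul, htr]
  congr 1
  rw [Matrix.trace_smul, Matrix.trace_one, smul_eq_mul]
  simp only [Fintype.card_pi, Fintype.card_bool, Finset.prod_const, Finset.card_univ,
    Fintype.card_fin, Nat.cast_pow, Nat.cast_ofNat]
  rw [mul_comm t n, pow_mul, mul_assoc, mul_inv_cancel₀ h2, mul_one]

theorem continuous_prod_marginal (x : Fin t → Bits m) :
    Continuous fun ψ : PureState (n + m) => ∏ j, marginal ψ (x j) :=
  continuous_finsetProd _ fun j _ => continuous_marginal (x j)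

theorem sum_integral_prod_marginal :
    ∑ x : Fin t → Bits m, ∫ ψ : PureState (n + m), ∏ j, marginal ψ (x j) ∂haarState (n + m) = 1 := by
  rw [← integral_finsetSum _ fun x _ => integrable_haarState (continuous_prod_marginal x)]
  have : ∀ ψ : PureState (n + m), ∑ x : Fin t → Bits m, ∏ j, marginal ψ (x j) = 1 := fun ψ => by
    rw [← Fintype.piFinset_univ, ← Finset.prod_univ_sum (f := fun _ b => marginal ψ b)]
    simp [sum_marginal]
  simp [this]

open scoped ComplexOrder in
open Classical in
/-- A test that is given by an effect distinguishes `t` copies of a state from the generalized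
Hilbert-Schmidt ensemble from `t` copies of the maximally mixed state at most as well as the traced
out registers collide. -/
theorem abs_integral_sub_maxMixed_le_collision (F : QMat (t * n) →ₗ[ℝ] ℝ)
    (h0 : ∀ X : QMat (t * n), X.PosSemidef → 0 ≤ F X)
    (h1 : ∀ X : QMat (t * n), X.PosSemidef → F X ≤ X.trace.re) :
    |∫ ψ, F (copies t (reducedState n m ψ)) ∂haarState (n + m) - F (copies t (maxMixed n))| ≤
      ∫ ψ : PureState (n + m), ∑ x : Fin t → Bits m with ¬ Function.Injective x,
          ∏ j, marginal ψ (x j) ∂haarState (n + m) := by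
  set w : (Fin t → Bits m) → ℝ := fun x =>
    ∫ ψ : PureState (n + m), ∏ j, marginal ψ (x j) ∂haarState (n + m) with hw
  set e : (Fin t → Bits m) → ℝ := fun x =>
    ∫ ψ : PureState (n + m), F (slice x ψ) ∂haarState (n + m) with he
  set f := F (copies t (maxMixed n)) with hf
  have hcont : ∀ x : Fin t → Bits m, Continuous fun ψ : PureState (n + m) => F (slice x ψ) :=
    fun x => continuous_linearMap_comp F (continuous_slice_apply x)
  have hw0 : ∀ x, 0 ≤ w x := fun x =>
    integral_nonneg fun ψ => Finset.prod_nonneg fun j _ => marginal_nonneg _ _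
  have he0 : ∀ x, 0 ≤ e x := fun x => integral_nonneg fun ψ => h0 _ (posSemidef_slice x ψ)
  have hew : ∀ x, e x ≤ w x := fun x =>
    integral_mono (integrable_haarState (hcont x)) (integrable_haarState (continuous_prod_marginal x))
      fun ψ => by
        have := h1 _ (posSemidef_slice x ψ)
        rwa [trace_slice, Complex.ofReal_re] at this
  have hmm : (copies t (maxMixed n)).PosSemidef := by
    rw [copies_maxMixed]
    exact Matrix.PosSemidef.one.smul (by positivity)
  have hf0 : 0 ≤ f := h0 _ hmm
  have hf1 : f ≤ 1 := by
    refine (h1 _ hmm).trans_eq ?_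
    rw [copies_maxMixed, Matrix.trace_smul, Matrix.trace_one, smul_eq_mul]
    simp only [Fintype.card_pi, Fintype.card_bool, Finset.prod_const, Finset.card_univ,
      Fintype.card_fin, Nat.cast_pow, Nat.cast_ofNat]
    rw [mul_comm t n, pow_mul, inv_mul_cancel₀ (pow_ne_zero _ (pow_ne_zero _ two_ne_zero)),
      Complex.one_re]
  have hinj : ∀ x, Function.Injective x → e x = w x * f := fun x hx => by
    simp only [he]
    rw [integral_linearMap_comp F (continuous_slice_apply x), integral_slice hx, map_smul,
      smul_eq_mul]
  have hint : ∫ ψ, F (copies t (reducedState n m ψ)) ∂haarState (n + m) = ∑ x, e x := by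
    simp_rw [copies_reducedState, map_sum]
    exact integral_finsetSum _ fun x _ => integrable_haarState (hcont x)
  -- The weights `w x` sum to 1, so `f` is the sum of `w x * f` and the collision-free terms cancel.
  have hdiff : ∑ x, e x - f =
      ∑ x : Fin t → Bits m with ¬ Function.Injective x, (e x - w x * f) := by
    rw [Finset.sum_filter_of_ne (p := fun x => ¬ Function.Injective x)
        fun x _ hne hx => hne (by rw [hinj x hx, sub_self]),
      Finset.sum_sub_distrib, ← Finset.sum_mul, sum_integral_prod_marginal, one_mul]
  calc _ = |∑ x : Fin t → Bits m with ¬ Function.Injective x, (e x - w x * f)| := by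
        rw [hint, hdiff]
    _ ≤ ∑ x : Fin t → Bits m with ¬ Function.Injective x, w x := by
        refine (Finset.abs_sum_le_sum_abs _ _).trans (Finset.sum_le_sum fun x _ => ?_)
        rw [abs_le]
        -- Both `e x` and `w x * f` lie in `[0, w x]`.
        constructor <;> nlinarith [hw0 x, he0 x, hew x]
    _ = ∫ ψ : PureState (n + m), ∑ x : Fin t → Bits m with ¬ Function.Injective x,
          ∏ j, marginal ψ (x j) ∂haarState (n + m) :=
        (integral_finsetSum _ fun x _ => integrable_haarState (continuous_prod_marginal x)).symm

open scoped ComplexOrder in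
/-- A test that is given by an effect hardly distinguishes `t` copies of a state from the generalized
Hilbert-Schmidt ensemble from `t` copies of the maximally mixed state. -/
theorem abs_integral_sub_maxMixed_le (F : QMat (t * n) →ₗ[ℝ] ℝ)
    (h0 : ∀ X : QMat (t * n), X.PosSemidef → 0 ≤ F X)
    (h1 : ∀ X : QMat (t * n), X.PosSemidef → F X ≤ X.trace.re) :
    |∫ ψ, F (copies t (reducedState n m ψ)) ∂haarState (n + m) - F (copies t (maxMixed n))| ≤
      2 * t ^ 2 / 2 ^ m := by
  classical
  refine (abs_integral_sub_maxMixed_le_collision F h0 h1).trans ?_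
  calc _ ≤ ∫ ψ : PureState (n + m), t ^ 2 * ∑ x, marginal ψ x ^ 2 ∂haarState (n + m) :=
        integral_mono
          (integrable_haarState (continuous_finsetSum _ fun x _ => continuous_prod_marginal x))
          (integrable_haarState (continuous_const.mul
            (continuous_finsetSum _ fun x _ => (continuous_marginal x).pow 2)))
          fun ψ => sum_not_injective_le (marginal_nonneg ψ) (sum_marginal ψ)
    _ = t ^ 2 * ((2 ^ n + 1) / (2 ^ (n + m) + 1)) := by
        rw [integral_const_mul]
        exact congrArg _ (integral_sum_normSq_sq n m)
    _ ≤ t ^ 2 * (2 / 2 ^ m) := by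
        refine mul_le_mul_of_nonneg_left ?_ (sq_nonneg _)
        rw [div_le_div_iff₀ (by positivity) (by positivity), pow_add]
        have : (1 : ℝ) ≤ 2 ^ n := one_le_pow₀ one_le_two
        nlinarith [pow_pos (zero_lt_two (α := ℝ)) m]
    _ = _ := by ring

end Copies

/-! ## Negligible functions -/

theorem PolyBounded.exists_le_pow {f : ℕ → ℕ} (hf : PolyBounded f) :
    ∃ d n₀ : ℕ, ∀ n ≥ n₀, f n ≤ n ^ d := by
  obtain ⟨p, hp⟩ := hf
  suffices h : ∃ d n₀ : ℕ, ∀ n ≥ n₀, p.eval n ≤ n ^ d by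
    obtain ⟨d, n₀, h⟩ := h
    exact ⟨d, n₀, fun n hn => (hp n).trans (h n hn)⟩
  clear hp
  induction p using Polynomial.induction_on' with
  | add p q hp hq =>
    obtain ⟨d, a, hp⟩ := hp
    obtain ⟨e, b, hq⟩ := hq
    refine ⟨max d e + 1, max (max a b) 2, fun n hn => ?_⟩
    have h2 : 2 ≤ n := (le_max_right _ _).trans hn
    have hd : n ^ d ≤ n ^ max d e := Nat.pow_le_pow_right (by omega) (le_max_left _ _)
    have he : n ^ e ≤ n ^ max d e := Nat.pow_le_pow_right (by omega) (le_max_right _ _)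
    rw [Polynomial.eval_add, pow_succ]
    have h3 := hp n (by omega)
    have h4 := hq n (by omega)
    nlinarith
  | monomial k c =>
    refine ⟨k + 1, c, fun n hn => ?_⟩
    rw [Polynomial.eval_monomial, pow_succ, mul_comm]
    exact Nat.mul_le_mul_left _ hn

theorem Negligible.add {μ ν : ℕ → ℝ} (hμ : Negligible μ) (hν : Negligible ν) :
    Negligible fun n => μ n + ν n := by
  refine ⟨fun n => add_pos (hμ.1 n) (hν.1 n), fun c => ?_⟩
  -- The extra power of `n` pays for the factor 2 once `n ≥ 2`.
  obtain ⟨a, ha⟩ := hμ.2 (c + 1)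
  obtain ⟨b, hb⟩ := hν.2 (c + 1)
  refine ⟨max (max a b) 2, fun n hn => ?_⟩
  have h2 : (2 : ℝ) ≤ n := by exact_mod_cast (show 2 ≤ n by omega)
  have h3 := ha n (by omega)
  have h4 := hb n (by omega)
  have h5 : ((n : ℝ) ^ (c + 1))⁻¹ ≤ ((n : ℝ) ^ c)⁻¹ / 2 := by
    rw [pow_succ, mul_inv, div_eq_mul_inv]
    gcongr
  linarith

theorem IsNegl.mono_add {l : ℕ → ℕ} {f g h : ℕ → ℝ} (hf : IsNegl l f) (hg : IsNegl l g)
    (hle : ∀ n, h n ≤ f n + g n) : IsNegl l h := by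
  obtain ⟨μ, hμ, hfμ⟩ := hf
  obtain ⟨ν, hν, hgν⟩ := hg
  exact ⟨_, hμ.add hν, fun n => (hle n).trans (add_le_add (hfμ n) (hgν n))⟩

theorem negligible_two_pow_inv : Negligible fun n => ((2 : ℝ) ^ n)⁻¹ := by
  refine ⟨fun n => by positivity, fun c => ?_⟩
  have h := tendsto_pow_const_div_const_pow_of_one_lt c (one_lt_two (α := ℝ))
  obtain ⟨n₀, h⟩ := eventually_atTop.1 (h.eventually_lt_const one_pos)
  refine ⟨n₀, fun n hn => ?_⟩
  have hn0 : 0 < (n : ℝ) ^ c := pow_pos (by exact_mod_cast (show 0 < n by omega)) _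
  have := h n hn.le
  rw [div_lt_one (by positivity)] at this
  exact inv_strictAnti₀ hn0 this

/-- A function that is negligible in `n` is negligible in every polynomially bounded parameter. -/
theorem isNegl_of_forall_pow {l : ℕ → ℕ} (hl : PolyBounded l) {f : ℕ → ℝ}
    (hf : ∀ c : ℕ, ∃ n₀ : ℕ, ∀ n > n₀, f n < ((n : ℝ) ^ c)⁻¹) : IsNegl l f := by
  -- A fibre of `l` may be infinite, and a real supremum without an upper bound would default to 0.
  have hbdd : BddAbove (Set.range fun n => max (f n) 0) := by
    obtain ⟨n₀, h⟩ := hf 0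
    refine (Filter.isBoundedUnder_of_eventually_le (a := 1) ?_).bddAbove_range
    filter_upwards [eventually_gt_atTop n₀] with n hn
    have := h n hn
    rw [pow_zero, inv_one] at this
    exact max_le this.le zero_le_one
  -- The worst value of `f` on each fibre of `l`, and 0 on an empty fibre. Adding `2 ^ (-k)` later
  -- makes it strictly positive.
  set ν : ℕ → ℝ := fun k => ⨆ n : {n // l n = k}, max (f n) 0 with hν
  have hbdd' : ∀ k, BddAbove (Set.range fun n : {n // l n = k} => max (f n) 0) := fun k =>
    hbdd.mono (by rintro _ ⟨n, rfl⟩; exact ⟨n, rfl⟩)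
  have hν0 : ∀ k, 0 ≤ ν k := fun k => Real.iSup_nonneg fun n => le_max_right _ _
  have hνneg : Negligible fun k => ν k + ((2 : ℝ) ^ k)⁻¹ := by
    refine ⟨fun k => add_pos_of_nonneg_of_pos (hν0 k) (by positivity), fun c => ?_⟩
    obtain ⟨d, a, hd⟩ := hl.exists_le_pow
    -- On the fibre, `k = l n ≤ n ^ d`, so this exponent yields `k ^ (-(c + 1))`.
    obtain ⟨b, hb⟩ := hf (d * (c + 1))
    obtain ⟨r, hr⟩ := negligible_two_pow_inv.2 (c + 1)
    -- Beyond `s`, the fibre over `k` contains only `n` large enough for both asymptotic bounds.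
    obtain ⟨s, hs⟩ : ∃ s, ∀ n ≤ max a b, l n ≤ s :=
      ⟨(Finset.range (max a b + 1)).sup l, fun n hn =>
        Finset.le_sup (f := l) (Finset.mem_range.2 (by omega))⟩
    refine ⟨max (max r s) 2, fun k hk => ?_⟩
    have h2 : (2 : ℝ) ≤ k := by exact_mod_cast (show 2 ≤ k by omega)
    have h5 : ((k : ℝ) ^ (c + 1))⁻¹ ≤ ((k : ℝ) ^ c)⁻¹ / 2 := by
      rw [pow_succ, mul_inv, div_eq_mul_inv]
      gcongr
    have h6 : ν k ≤ ((k : ℝ) ^ (c + 1))⁻¹ := by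
      refine Real.iSup_le (fun ⟨n, hn⟩ => max_le ?_ (by positivity)) (by positivity)
      have hnab : max a b < n := by
        by_contra hle
        have := hs n (not_lt.1 hle)
        omega
      refine (hb n (by omega)).le.trans ?_
      have h7 : (k : ℝ) ≤ (n : ℝ) ^ d := by exact_mod_cast hn ▸ hd n (by omega)
      rw [pow_mul]
      gcongr
    have := hr k (by omega)
    linarith
  refine ⟨_, hνneg, fun n => ?_⟩
  have h1 : f n ≤ ν (l n) :=
    (le_max_left _ _).trans (le_ciSup (hbdd' (l n)) ⟨n, rfl⟩)
  have : (0 : ℝ) < ((2 : ℝ) ^ l n)⁻¹ := by positivity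
  linarith

/-- If `t` is polynomially bounded and `m` grows faster than the logarithm, then `t² / 2 ^ m` vanishes
faster than every inverse polynomial. -/
theorem exists_two_mul_sq_div_lt {t m : ℕ → ℕ} (ht : PolyBounded t)
    (hm : (fun n : ℕ => Real.log n) =o[atTop] fun n : ℕ => (m n : ℝ)) (c : ℕ) :
    ∃ n₀ : ℕ, ∀ n > n₀, 2 * (t n : ℝ) ^ 2 / 2 ^ m n < ((n : ℝ) ^ c)⁻¹ := by
  obtain ⟨d, a, hd⟩ := ht.exists_le_pow
  -- `2 * d + c` comes from `t² n ^ c`; one more power absorbs the factor 2, and another gives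
  -- strictness. The little-o constant `log 2 / e` is chosen to make `n ^ e ≤ 2 ^ m n`.
  set e : ℕ := 2 * d + c + 2 with he
  have hlog := hm.def (c := Real.log 2 / e) (div_pos (Real.log_pos one_lt_two) (by positivity))
  obtain ⟨b, hb⟩ := eventually_atTop.1 hlog
  refine ⟨max (max a b) 2, fun n hn => ?_⟩
  have h2 : (2 : ℝ) ≤ n := by exact_mod_cast (show 2 ≤ n by omega)
  have hn0 : (0 : ℝ) < n := by linarith
  have h3 : (n : ℝ) ^ e ≤ 2 ^ m n := by
    have h4 := hb n (by omega)
    rw [Real.norm_of_nonneg (Real.log_nonneg (by linarith)), Real.norm_of_nonneg (by positivity),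
      div_mul_eq_mul_div, le_div_iff₀ (by positivity)] at h4
    rw [← Real.log_le_log_iff (by positivity) (by positivity), Real.log_pow, Real.log_pow]
    linarith
  have h5 : (t n : ℝ) ≤ (n : ℝ) ^ d := by exact_mod_cast hd n (by omega)
  rw [div_lt_iff₀ (by positivity), inv_mul_eq_div, lt_div_iff₀ (by positivity)]
  calc 2 * (t n : ℝ) ^ 2 * (n : ℝ) ^ c ≤ n * ((n : ℝ) ^ d) ^ 2 * (n : ℝ) ^ c := by gcongr
    _ = (n : ℝ) ^ (2 * d + c + 1) := by ring
    _ < (n : ℝ) ^ e := pow_lt_pow_right₀ (by linarith) (by omega)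
    _ ≤ 2 ^ m n := h3

end QCrypto

theorem mainTheorem10 (G : QCrypto.GateSet) (lam m : ℕ → ℕ)
    (ρ : ∀ n, QCrypto.Bits (lam n) → QCrypto.QMat n)
    (hρ : QCrypto.IsVPRDM G lam m ρ)
    (hm : (fun n : ℕ => Real.log n) =o[Filter.atTop] fun n : ℕ => (m n : ℝ))
    (A : QCrypto.QPTAlgorithm) (t : ℕ → ℕ) (ht : QCrypto.PolyBounded t) :
    QCrypto.IsNegl lam fun n =>
      |QCrypto.keyAverage (fun k => QCrypto.distProb G A n (lam n) (t n) (ρ n k)) -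
        QCrypto.distProb G A n (lam n) (t n) (QCrypto.maxMixed n)| := by
  have hclose := QCrypto.isNegl_of_forall_pow hρ.lam_poly
    (QCrypto.exists_two_mul_sq_div_lt ht hm)
  refine (hρ.indistinguishable A t ht).mono_add hclose fun n => ?_
  refine (abs_sub_le _ (∫ ψ, QCrypto.distProb G A n (lam n) (t n)
    (QCrypto.reducedState n (m n) ψ) ∂QCrypto.haarState (n + m n)) _).trans ?_
  gcongr
  exact QCrypto.abs_integral_sub_maxMixed_le (QCrypto.Circuit.acceptFunctional G _)
    (fun _ h => QCrypto.Circuit.acceptProb_nonneg G _ h)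
    (fun _ h => QCrypto.Circuit.acceptProb_le_trace G _ h)
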